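/- A diffeological space is a set $X$ together with a family of maps $U\to X$ (called plots), for $U$ ranging over the open subsets of the spaces $\mathbb{R}^n$, $n\in\mathbb{N}$, such that constant maps are plots, plots precomposed with smooth maps between open subsets of Euclidean spaces are plots, and a map is a plot if and only if it is locally a plot. For $x\in X$, the internal tangent space $T^{\mathrm{dvs}}_x(X)$ is, as a real vector space, the colimit of the tangent spaces $T_0(U)$ over the category of pointed plots $p:(U,0)\to(X,x)$, whose morphisms from $p:(U,0)\to (X,x)$ to $q:(V,0)\to (X,x)$ are the smooth maps $f:(U,0)\to(V,0)$ with $q\circ f=p$, acting by $f_*:T_0(U)\to T_0(V)$. A pointed plot $p$ induces a linear map $p_*:T_0(U)\to T^{\mathrm{dvs}}_x(X)$. Let $\mathbb{R}^2_S$ be the set $\mathbb{R}^2$ with the spaghetti diffeology, that is, the smallest diffeology for which all smooth maps $\mathbb{R}\to\mathbb{R}^2$ are plots. **Proposition 6.1.** For each $x\in\mathbb{R}^2_S$, the tangent space $T^{\mathrm{dvs}}_x(\mathbb{R}^2_S)$ has uncountable dimension as a real vector space. Moreover, writing $p_m:(\mathbb{R},0)\to(\mathbb{R}^2_S,0)$,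 $p_m(t)=(t,mt)$, the family of tangent vectors $(p_m)_*\left(\frac{d}{dt}\big|_0\right)\in T^{\mathrm{dvs}}_0(\mathbb{R}^2_S)$, $m\in\mathbb{R}$, is linearly independent. -/

import Mathlib

open scoped ContDiff

noncomputable section

namespace Diffeology

/-- A map `p : u → X` on an open subset `u` of `ℝⁿ` is a plot of `X`. Mathlib records a diffeology
through its plots with domain the whole of some `ℝᵐ`; by the sheaf property, a map on an open set
is a plot iff all its smooth reparametrizations by some `ℝᵐ` are. -/
def IsPlotOn {X : Type*} [DiffeologicalSpace X] {n : ℕ} (u : Set (EuclideanSpace ℝ (Fin n)))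
    (p : u → X) : Prop :=
  ∀ (m : ℕ) (f : EuclideanSpace ℝ (Fin m) → u),
    ContDiff ℝ ∞ (fun y => (f y : EuclideanSpace ℝ (Fin n))) → IsPlot (p ∘ f)

/-- The objects of the pointed plot category of `(X, x)`: plots `p : (U, 0) → (X, x)` with `U` an
open neighbourhood of `0` in some `ℝⁿ`. -/
structure PointedPlot {X : Type*} [DiffeologicalSpace X] (x : X) where
  /-- The dimension of the domain. -/
  dim : ℕ
  /-- The domain. -/
  dom : Set (EuclideanSpace ℝ (Fin dim))
  isOpen_dom : IsOpen dom
  zero_mem : (0 : EuclideanSpace ℝ (Fin dim)) ∈ dom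
  /-- The underlying map. -/
  toFun : dom → X
  isPlotOn : IsPlotOn dom toFun
  map_zero : toFun ⟨0, zero_mem⟩ = x

/-- The morphisms of the pointed plot category of `(X, x)`: the restriction of `f` to the domain
`U` of `p` is a smooth map `(U, 0) → (V, 0)` into the domain `V` of `q`, and `q ∘ f = p` on `U`.
(The values of `f` outside the open set `U` play no role.) -/
structure PointedPlot.IsHom {X : Type*} [DiffeologicalSpace X] {x : X} (p q : PointedPlot x)
    (f : EuclideanSpace ℝ (Fin p.dim) → EuclideanSpace ℝ (Fin q.dim)) : Prop where
  contDiffOn : ContDiffOn ℝ ∞ f p.dom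
  mapsTo : Set.MapsTo f p.dom q.dom
  map_zero : f 0 = 0
  comp_eq : ∀ (u : EuclideanSpace ℝ (Fin p.dim)) (hu : u ∈ p.dom),
    q.toFun ⟨f u, mapsTo hu⟩ = p.toFun ⟨u, hu⟩

open Classical in
/-- The relations defining the colimit of `p ↦ T₀(dom p)`: a vector `v ∈ T₀(dom p) = ℝⁿ` is
identified with its image `f_* v ∈ T₀(dom q)` under every morphism `f : p → q`. -/
def tangentRelations {X : Type*} [DiffeologicalSpace X] (x : X) :
    Submodule ℝ (DirectSum (PointedPlot x) fun p => EuclideanSpace ℝ (Fin p.dim)) :=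
  Submodule.span ℝ {w | ∃ (p q : PointedPlot x)
    (f : EuclideanSpace ℝ (Fin p.dim) → EuclideanSpace ℝ (Fin q.dim)) (_ : p.IsHom q f)
    (v : EuclideanSpace ℝ (Fin p.dim)),
    w = DirectSum.lof ℝ (PointedPlot x) (fun p => EuclideanSpace ℝ (Fin p.dim)) q (fderiv ℝ f 0 v)
      - DirectSum.lof ℝ (PointedPlot x) (fun p => EuclideanSpace ℝ (Fin p.dim)) p v}

/-- The internal tangent space of the diffeological space `X` at `x`, as a real vector space: the
colimit of `T₀(U)` over the pointed plots `(U, 0) → (X, x)`, constructed as the direct sum of the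
`T₀(U)` modulo the relations given by the morphisms. It is the fibre over `x` of the internal
tangent bundle `T^dvs X`; the dvs diffeology does not affect the vector space structure of the
fibres. -/
abbrev InternalTangentSpace {X : Type*} [DiffeologicalSpace X] (x : X) : Type _ :=
  (DirectSum (PointedPlot x) fun p => EuclideanSpace ℝ (Fin p.dim)) ⧸ tangentRelations x

open Classical in
/-- The structure map `p_* : T₀(U) → T_x(X)` of the colimit, for a pointed plot
`p : (U, 0) → (X, x)`. -/
def PointedPlot.pushforward {X : Type*} [DiffeologicalSpace X] {x : X} (p : PointedPlot x) :
    EuclideanSpace ℝ (Fin p.dim) →ₗ[ℝ] InternalTangentSpace x :=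
  (tangentRelations x).mkQ ∘ₗ
    DirectSum.lof ℝ (PointedPlot x) (fun p => EuclideanSpace ℝ (Fin p.dim)) p

/-- A smooth curve `c : ℝ → X` with `c 0 = x`, as a pointed plot of `(X, x)` (with `ℝ` seen as
`ℝ¹`). -/
def PointedPlot.ofCurve {X : Type*} [DiffeologicalSpace X] {x : X} (c : ℝ → X) (hc : DSmooth c)
    (h0 : c 0 = x) : PointedPlot x where
  dim := 1
  dom := Set.univ
  isOpen_dom := isOpen_univ
  zero_mem := Set.mem_univ _
  toFun t := c ((t : EuclideanSpace ℝ (Fin 1)) 0)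
  isPlotOn m f hf := by
    refine hc m (fun y => (f y : EuclideanSpace ℝ (Fin 1)) 0) (ContDiff.isPlot ?_)
    exact (contDiff_euclidean.1 hf) 0
  map_zero := h0

/-- The tangent vector `c_* (d/dt) ∈ T_x(X)` at `t = 0` of a smooth curve `c` with `c 0 = x`. -/
def velocity {X : Type*} [DiffeologicalSpace X] {x : X} (c : ℝ → X) (hc : DSmooth c)
    (h0 : c 0 = x) : InternalTangentSpace x :=
  (PointedPlot.ofCurve c hc h0).pushforward (EuclideanSpace.single (0 : Fin 1) (1 : ℝ))

/-- The plane `ℝ²`, to be equipped with the spaghetti diffeology. -/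
def SpaghettiPlane : Type := EuclideanSpace ℝ (Fin 2)

/-- The spaghetti (or wire) diffeology on `ℝ²`: the diffeology generated by all smooth maps
`ℝ → ℝ²`. -/
instance SpaghettiPlane.instDiffeologicalSpace : DiffeologicalSpace SpaghettiPlane :=
  DiffeologicalSpace.generateFrom
    {P | ∃ c : ℝ → EuclideanSpace ℝ (Fin 2), ContDiff ℝ ∞ c ∧
      P = ⟨1, fun t : EuclideanSpace ℝ (Fin 1) => c (t 0)⟩}

/-- The origin of the plane. -/
def SpaghettiPlane.origin : SpaghettiPlane := (0 : EuclideanSpace ℝ (Fin 2))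

/-- The line `t ↦ (t, m t)`. -/
def SpaghettiPlane.line (m : ℝ) : ℝ → SpaghettiPlane :=
  fun t => (!₂[t, m * t] : EuclideanSpace ℝ (Fin 2))

theorem SpaghettiPlane.dSmooth_of_contDiff {c : ℝ → EuclideanSpace ℝ (Fin 2)}
    (hc : ContDiff ℝ ∞ c) : DSmooth (Y := SpaghettiPlane) c := by
  intro n p hp
  have hp' : ContDiff ℝ ∞ p := hp.contDiff
  have hg : ContDiff ℝ ∞ (fun y => (EuclideanSpace.single (0 : Fin 1) (p y))) := by
    rw [contDiff_euclidean]
    intro i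
    fin_cases i
    simpa using hp'
  have key : IsPlot (X := SpaghettiPlane) (fun t : EuclideanSpace ℝ (Fin 1) => c (t 0)) :=
    DiffeologicalSpace.isPlot_generatedFrom_of_mem ⟨c, hc, rfl⟩
  have h := isPlot_reparam key hg
  have e : c ∘ p = (fun t : EuclideanSpace ℝ (Fin 1) => c (t 0)) ∘
      fun y => EuclideanSpace.single (0 : Fin 1) (p y) := by
    funext y
    have h1 : (EuclideanSpace.single (0 : Fin 1) (p y)) 0 = p y := by simp
    exact (congrArg c h1).symm
  exact e ▸ h

theorem SpaghettiPlane.dSmooth_line (m : ℝ) : DSmooth (SpaghettiPlane.line m) := by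
  refine SpaghettiPlane.dSmooth_of_contDiff (c := fun t => !₂[t, m * t]) ?_
  rw [contDiff_euclidean]
  intro i
  fin_cases i
  · exact contDiff_id
  · exact contDiff_const.mul contDiff_id

theorem SpaghettiPlane.line_zero (m : ℝ) : SpaghettiPlane.line m 0 = SpaghettiPlane.origin := by
  change (!₂[(0 : ℝ), m * 0] : EuclideanSpace ℝ (Fin 2)) = 0
  ext i
  fin_cases i <;> simp

end Diffeology

end

noncomputable section

namespace Diffeology

/-! ### Plots of the spaghetti plane have rank at most one. -/

open Topology

/-! Spaghetti plots have derivatives of rank at most one, since the generating curves do and this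
condition defines a diffeology (`IsPlot.isSmoothOfRankLEOne`). So each slope `m` gives a functional
on the colimit: on a pointed plot whose derivative at `0` has image in the line of slope `m`, take
the first component of the derivative; on any other plot, take `0`. The case split depends on the
plot alone, so each piece is linear. By the rank bound, a morphism cannot carry a nonzero vector of
slope `m` into a plot without that slope, so the pieces descend to the colimit
(`PointedPlot.IsHom.slopePart_eq`). These functionals are dual to the velocities `(1, k)`, which are
therefore independent; there are continuum many. -/

theorem exists_contDiff_mem_eventuallyEq_id {E : Type*} [NormedAddCommGroup E]
    [InnerProductSpace ℝ E] [FiniteDimensional ℝ E] {u : Set E} (hu : IsOpen u) {x : E}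
    (hx : x ∈ u) :
    ∃ f : E → E, ContDiff ℝ ∞ f ∧ (∀ y, f y ∈ u) ∧ f =ᶠ[𝓝 x] id := by
  obtain ⟨ε, hε, hball⟩ := Metric.isOpen_iff.1 hu x hx
  let ρ : ContDiffBump x := ⟨ε / 2, ε, by positivity, by linarith⟩
  -- Contract towards `x` by a bump function: the identity where `ρ = 1`, constantly `x` outside the
  -- ball.
  refine ⟨fun y => x + ρ y • (y - x), ?_, fun y => hball ?_, ?_⟩
  · exact contDiff_const.add (ρ.contDiff.smul (contDiff_id.sub contDiff_const))
  · by_cases hy : y ∈ Metric.ball x ε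
    · rw [mem_ball_iff_norm] at hy ⊢
      rw [add_sub_cancel_left, norm_smul, Real.norm_of_nonneg ρ.nonneg]
      exact (mul_le_of_le_one_left (norm_nonneg _) ρ.le_one).trans_lt hy
    · have h0 : ρ y = 0 := ρ.zero_of_le_dist (by simpa using hy)
      simpa [h0] using hε
  · filter_upwards [ρ.eventuallyEq_one] with y hy
    simp [hy]

/-- A smooth map into the plane all of whose derivatives have rank at most one. -/
def IsSmoothOfRankLEOne {n : ℕ} (p : EuclideanSpace ℝ (Fin n) → EuclideanSpace ℝ (Fin 2)) :
    Prop :=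
  ContDiff ℝ ∞ p ∧ ∀ x, ∃ w, ∀ v, ∃ a : ℝ, fderiv ℝ p x v = a • w

theorem IsSmoothOfRankLEOne.comp {n m : ℕ}
    {p : EuclideanSpace ℝ (Fin m) → EuclideanSpace ℝ (Fin 2)}
    {f : EuclideanSpace ℝ (Fin n) → EuclideanSpace ℝ (Fin m)}
    (hp : IsSmoothOfRankLEOne p) (hf : ContDiff ℝ ∞ f) : IsSmoothOfRankLEOne (p ∘ f) := by
  refine ⟨hp.1.comp hf, fun x => ?_⟩
  obtain ⟨w, hw⟩ := hp.2 (f x)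
  refine ⟨w, fun v => ?_⟩
  rw [fderiv_comp x (hp.1.differentiable (by simp) _) (hf.differentiable (by simp) _)]
  exact hw _

/-- The diffeology on the plane of the smooth maps with derivatives of rank at most one. -/
@[reducible]
def rankLEOneDiffeology : DiffeologicalSpace SpaghettiPlane where
  plots _ := {p | IsSmoothOfRankLEOne p}
  constant_plots x := by
    refine ⟨contDiff_const, fun y => ⟨0, fun v => ⟨0, ?_⟩⟩⟩
    rw [zero_smul]
    exact congrArg (· v) (hasFDerivAt_const (𝕜 := ℝ) (F := EuclideanSpace ℝ (Fin 2)) x y).fderiv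
  plot_reparam hp hf := hp.comp hf
  locality {n p} hp := by
    have key : ∀ x, ∃ q : EuclideanSpace ℝ (Fin n) → EuclideanSpace ℝ (Fin 2),
        IsSmoothOfRankLEOne q ∧ q =ᶠ[𝓝 x] p := by
      intro x
      obtain ⟨u, hu, hxu, h⟩ := hp x
      obtain ⟨f, hf, hfu, hfx⟩ := exists_contDiff_mem_eventuallyEq_id hu hxu
      exact ⟨p ∘ f, h hfu hf, hfx.fun_comp p⟩
    refine ⟨contDiff_iff_contDiffAt.2 fun x => ?_, fun x => ?_⟩ <;>
      obtain ⟨q, hq, hqp⟩ := key x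
    · exact hq.1.contDiffAt.congr_of_eventuallyEq hqp.symm
    · obtain ⟨w, hw⟩ := hq.2 x
      exact ⟨w, fun v => hqp.fderiv_eq (𝕜 := ℝ) ▸ hw v⟩

theorem IsPlot.isSmoothOfRankLEOne {n : ℕ} {p : EuclideanSpace ℝ (Fin n) → SpaghettiPlane}
    (hp : IsPlot p) : IsSmoothOfRankLEOne p := by
  -- By minimality of the generated diffeology, only the generating curves need checking.
  have hle : SpaghettiPlane.instDiffeologicalSpace ≤ rankLEOneDiffeology := by
    refine DiffeologicalSpace.generateFrom_le_iff_subset_toPlots.2 ?_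
    rintro _ ⟨c, hc, rfl⟩
    have h0 : ContDiff ℝ ∞ fun t : EuclideanSpace ℝ (Fin 1) => t 0 :=
      contDiff_euclidean.1 contDiff_id 0
    refine ⟨hc.comp h0, fun x => ⟨deriv c (x 0), fun v => ⟨fderiv ℝ (fun t => t 0) x v, ?_⟩⟩⟩
    have h := ((hc.differentiable (by simp) (x 0)).hasDerivAt.hasFDerivAt.comp x
      (h0.differentiable (by simp) x).hasFDerivAt)
    exact congrArg (fun L => L v) h.fderiv
  exact DiffeologicalSpace.le_iff'.1 hle n p hp

/-! ### Derivatives of pointed plots and slope functionals. -/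

namespace PointedPlot

variable {x : SpaghettiPlane}

open Classical in
/-- The extension by zero of a pointed plot, as a map between Euclidean spaces. -/
def extend (p : PointedPlot x) : EuclideanSpace ℝ (Fin p.dim) → EuclideanSpace ℝ (Fin 2) :=
  fun y => if h : y ∈ p.dom then p.toFun ⟨y, h⟩ else (0 : EuclideanSpace ℝ (Fin 2))

theorem extend_apply (p : PointedPlot x) {y : EuclideanSpace ℝ (Fin p.dim)} (hy : y ∈ p.dom) :
    p.extend y = p.toFun ⟨y, hy⟩ := by
  exact dif_pos hy

/-- Passes from a plot on an open set to a globally defined one with the same germ at `0`, where the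
rank bound is available. -/
theorem exists_isSmoothOfRankLEOne (p : PointedPlot x) :
    ∃ q, IsSmoothOfRankLEOne q ∧ q =ᶠ[𝓝 0] p.extend := by
  obtain ⟨f, hf, hfu, hf0⟩ := exists_contDiff_mem_eventuallyEq_id p.isOpen_dom p.zero_mem
  refine ⟨_, (p.isPlotOn _ (fun y => ⟨f y, hfu y⟩) hf).isSmoothOfRankLEOne, ?_⟩
  filter_upwards [hf0] with y hy
  refine (p.extend_apply (hfu y)).symm.trans ?_
  rw [hy, id]

/-- The derivative at zero of a pointed plot of the plane. -/
def derivative (p : PointedPlot x) :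
    EuclideanSpace ℝ (Fin p.dim) →L[ℝ] EuclideanSpace ℝ (Fin 2) :=
  fderiv ℝ p.extend 0

theorem differentiableAt_extend (p : PointedPlot x) : DifferentiableAt ℝ p.extend 0 := by
  obtain ⟨q, hq, hqp⟩ := p.exists_isSmoothOfRankLEOne
  exact (hq.1.differentiable (by simp) 0).congr_of_eventuallyEq hqp.symm

theorem exists_derivative_eq_smul (p : PointedPlot x) :
    ∃ w, ∀ v, ∃ a : ℝ, p.derivative v = a • w := by
  obtain ⟨q, hq, hqp⟩ := p.exists_isSmoothOfRankLEOne
  rw [derivative, ← hqp.fderiv_eq (𝕜 := ℝ)]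
  exact hq.2 0

theorem IsHom.derivative_eq {p q : PointedPlot x}
    {f : EuclideanSpace ℝ (Fin p.dim) → EuclideanSpace ℝ (Fin q.dim)} (hf : p.IsHom q f)
    (v : EuclideanSpace ℝ (Fin p.dim)) : q.derivative (fderiv ℝ f 0 v) = p.derivative v := by
  have hnhds := p.isOpen_dom.mem_nhds p.zero_mem
  have hfd : DifferentiableAt ℝ f 0 :=
    (hf.contDiffOn.contDiffAt hnhds).differentiableAt (by simp)
  have hq : DifferentiableAt ℝ q.extend (f 0) := hf.map_zero.symm ▸ q.differentiableAt_extend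
  have heq : p.extend =ᶠ[𝓝 0] q.extend ∘ f := by
    filter_upwards [hnhds] with y hy
    rw [Function.comp_apply, q.extend_apply (hf.mapsTo hy), p.extend_apply hy, hf.comp_eq y hy]
  rw [derivative, derivative, heq.fderiv_eq, fderiv_comp 0 hq hfd, hf.map_zero]
  rfl

/-- The image of the derivative at zero of `p` lies in the line of slope `m`. -/
def HasSlope (p : PointedPlot x) (m : ℝ) : Prop :=
  ∀ v, p.derivative v 1 = m * p.derivative v 0

open Classical in
/-- The first component of the derivative of a pointed plot if the plot has slope `m`, and zero
otherwise. -/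
def slopePart (m : ℝ) (p : PointedPlot x) : EuclideanSpace ℝ (Fin p.dim) →ₗ[ℝ] ℝ :=
  if p.HasSlope m then
    (EuclideanSpace.proj (0 : Fin 2) ∘L p.derivative : EuclideanSpace ℝ (Fin p.dim) →L[ℝ] ℝ)
  else 0

theorem slopePart_of_hasSlope {m : ℝ} {p : PointedPlot x} (h : p.HasSlope m)
    (v : EuclideanSpace ℝ (Fin p.dim)) : slopePart m p v = p.derivative v 0 := by
  simp [slopePart, h]

theorem slopePart_of_not_hasSlope {m : ℝ} {p : PointedPlot x} (h : ¬ p.HasSlope m)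
    (v : EuclideanSpace ℝ (Fin p.dim)) : slopePart m p v = 0 := by
  simp [slopePart, h]

/-- The chain rule puts the derivative image of `p` inside that of `q`. The delicate case is `p` of
slope `m` and `q` not: then the derivative of `p` must vanish, since a nonzero value on the line
would span the whole image for `q`. -/
theorem IsHom.slopePart_eq {p q : PointedPlot x}
    {f : EuclideanSpace ℝ (Fin p.dim) → EuclideanSpace ℝ (Fin q.dim)} (hf : p.IsHom q f) (m : ℝ)
    (v : EuclideanSpace ℝ (Fin p.dim)) :
    slopePart m q (fderiv ℝ f 0 v) = slopePart m p v := by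
  by_cases hq : q.HasSlope m
  · have hp : p.HasSlope m := fun w => by simpa only [hf.derivative_eq] using hq (fderiv ℝ f 0 w)
    rw [slopePart_of_hasSlope hq, slopePart_of_hasSlope hp, hf.derivative_eq]
  · rw [slopePart_of_not_hasSlope hq]
    by_cases hp : p.HasSlope m
    · rw [slopePart_of_hasSlope hp]
      by_contra hne
      obtain ⟨w, hw⟩ := q.exists_derivative_eq_smul
      obtain ⟨a, ha⟩ := hw (fderiv ℝ f 0 v)
      rw [hf.derivative_eq] at ha
      have hm := hp v
      have ha0 : a ≠ 0 := by
        rintro rfl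
        simp [ha] at hne
      -- Cancelling `a` puts the spanning vector `w`, hence the whole derivative image of `q`, on
      -- the line of slope `m`.
      have hw1 : w 1 = m * w 0 := by
        simp only [ha, PiLp.smul_apply, smul_eq_mul] at hm
        exact mul_left_cancel₀ ha0 (by linarith)
      refine hq fun z => ?_
      obtain ⟨b, hb⟩ := hw z
      simp only [hb, PiLp.smul_apply, smul_eq_mul, hw1]
      ring
    · rw [slopePart_of_not_hasSlope hp]

end PointedPlot

open Classical in
/-- The linear functional on the internal tangent space of the spaghetti plane that reads off the
first component of the tangent vectors of slope `m`. -/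
def slopeFunctional (x : SpaghettiPlane) (m : ℝ) : InternalTangentSpace x →ₗ[ℝ] ℝ :=
  (tangentRelations x).liftQ
    (DirectSum.toModule ℝ (PointedPlot x) ℝ fun p => PointedPlot.slopePart m p) <| by
    refine Submodule.span_le.2 ?_
    rintro _ ⟨p, q, f, hf, v, rfl⟩
    rw [SetLike.mem_coe, LinearMap.mem_ker, map_sub, DirectSum.toModule_lof,
      DirectSum.toModule_lof, hf.slopePart_eq, sub_self]

theorem slopeFunctional_pushforward {x : SpaghettiPlane} (m : ℝ) (p : PointedPlot x)
    (v : EuclideanSpace ℝ (Fin p.dim)) :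
    slopeFunctional x m (p.pushforward v) = PointedPlot.slopePart m p v := by
  classical
  exact DirectSum.toModule_lof ..

/-! ### Velocities of curves and linear independence. -/

theorem derivative_ofCurve {x : SpaghettiPlane} {c : ℝ → SpaghettiPlane} (hc : DSmooth c)
    (h0 : c 0 = x) {c' : EuclideanSpace ℝ (Fin 2)}
    (h : HasDerivAt (F := EuclideanSpace ℝ (Fin 2)) c c' 0) (v : EuclideanSpace ℝ (Fin 1)) :
    (PointedPlot.ofCurve c hc h0).derivative v = v 0 • c' := by
  have hp : HasFDerivAt (fun t : EuclideanSpace ℝ (Fin 1) => t 0)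
      (EuclideanSpace.proj (0 : Fin 1) : EuclideanSpace ℝ (Fin 1) →L[ℝ] ℝ) 0 :=
    (EuclideanSpace.proj (0 : Fin 1) : EuclideanSpace ℝ (Fin 1) →L[ℝ] ℝ).hasFDerivAt
  have hcomp := HasFDerivAt.comp (0 : EuclideanSpace ℝ (Fin 1)) h.hasFDerivAt hp
  have hext : (PointedPlot.ofCurve c hc h0).extend = fun t : EuclideanSpace ℝ (Fin 1) => c (t 0) :=
    funext fun t => PointedPlot.extend_apply _ (Set.mem_univ t)
  rw [PointedPlot.derivative, hext]
  exact congrArg (fun L => L v) hcomp.fderiv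

theorem slopeFunctional_velocity {x : SpaghettiPlane} {c : ℝ → SpaghettiPlane} (hc : DSmooth c)
    (h0 : c 0 = x) {k : ℝ}
    (h : HasDerivAt (F := EuclideanSpace ℝ (Fin 2)) c !₂[1, k] 0) (m : ℝ) :
    slopeFunctional x m (velocity c hc h0) = if k = m then 1 else 0 := by
  have hd := derivative_ofCurve hc h0 h
  have hunit (i : Fin 2) : (PointedPlot.ofCurve c hc h0).derivative
      (EuclideanSpace.single (0 : Fin 1) (1 : ℝ)) i = (!₂[1, k] : EuclideanSpace ℝ (Fin 2)) i :=
    (congrArg (· i) (hd (EuclideanSpace.single 0 1))).trans (by simp)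
  rw [velocity, slopeFunctional_pushforward]
  split_ifs with hk
  · have hs : (PointedPlot.ofCurve c hc h0).HasSlope m := fun v => by
      have hv := hd v
      simp [hv, hk, mul_comm]
    exact (PointedPlot.slopePart_of_hasSlope hs _).trans (hunit 0)
  · refine PointedPlot.slopePart_of_not_hasSlope (fun hs => hk ?_) _
    exact (hunit 1).symm.trans
      ((hs _).trans ((congrArg (m * ·) (hunit 0)).trans (mul_one m)))

theorem linearIndependent_velocity {x : SpaghettiPlane} {c : ℝ → ℝ → SpaghettiPlane}
    (hc : ∀ k, DSmooth (c k)) (h0 : ∀ k, c k 0 = x)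
    (h : ∀ k, HasDerivAt (F := EuclideanSpace ℝ (Fin 2)) (c k) !₂[1, k] 0) :
    LinearIndependent ℝ fun k => velocity (c k) (hc k) (h0 k) :=
  .of_pairwise_dual_eq_zero_one _ (slopeFunctional x)
    (fun i j hij => by simp [slopeFunctional_velocity _ _ (h _), hij.symm])
    (fun i => by simp [slopeFunctional_velocity _ _ (h _)])

theorem SpaghettiPlane.hasDerivAt_line (k : ℝ) :
    HasDerivAt (F := EuclideanSpace ℝ (Fin 2)) (SpaghettiPlane.line k) !₂[1, k] 0 := by
  have h : HasDerivAt (fun t : ℝ => t • (!₂[1, k] : EuclideanSpace ℝ (Fin 2))) !₂[1, k] 0 := by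
    simpa using (hasDerivAt_id (0 : ℝ)).smul_const (!₂[1, k] : EuclideanSpace ℝ (Fin 2))
  refine h.congr_of_eventuallyEq (.of_forall fun t => ?_)
  change (!₂[t, k * t] : EuclideanSpace ℝ (Fin 2)) = _
  ext i
  fin_cases i <;> simp [mul_comm]

theorem aleph0_lt_rank_internalTangentSpace (x : SpaghettiPlane) :
    Cardinal.aleph0 < Module.rank ℝ (InternalTangentSpace x) := by
  let x' : EuclideanSpace ℝ (Fin 2) := x
  -- The lines through `x`, one for each slope `k`.
  let c : ℝ → ℝ → EuclideanSpace ℝ (Fin 2) := fun k t => x' + t • !₂[1, k]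
  have hc : ∀ k, DSmooth (Y := SpaghettiPlane) (c k) := fun k =>
    SpaghettiPlane.dSmooth_of_contDiff (c := c k)
      (contDiff_const.add (contDiff_id.smul contDiff_const))
  have h0 : ∀ k, c k 0 = x := fun k => show x' + (0 : ℝ) • _ = x' by simp
  have h : ∀ k, HasDerivAt (c k) !₂[1, k] 0 := fun k => by
    have hk := ((hasDerivAt_id (0 : ℝ)).smul_const
      (!₂[1, k] : EuclideanSpace ℝ (Fin 2))).const_add x'
    rwa [one_smul] at hk
  have hcard := (linearIndependent_velocity hc h0 h).cardinal_le_rank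
  rw [Cardinal.mk_real] at hcard
  exact Cardinal.aleph0_lt_continuum.trans_le hcard

end Diffeology

end

theorem proposition6p1 :
    (∀ x : Diffeology.SpaghettiPlane,
      Cardinal.aleph0 < Module.rank ℝ (Diffeology.InternalTangentSpace x)) ∧
    LinearIndependent ℝ (fun m : ℝ =>
      (Diffeology.velocity (Diffeology.SpaghettiPlane.line m)
        (Diffeology.SpaghettiPlane.dSmooth_line m) (Diffeology.SpaghettiPlane.line_zero m) :
        Diffeology.InternalTangentSpace Diffeology.SpaghettiPlane.origin)) :=
  ⟨Diffeology.aleph0_lt_rank_internalTangentSpace, Diffeology.linearIndependent_velocity _ _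
    Diffeology.SpaghettiPlane.hasDerivAt_line⟩
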